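/- A map between topological spaces is called open if it is continuous and the image of each open set is open. Let $\mathsf{TopOpen}$ be the category of topological spaces and open maps, let $\mathsf{TopOpen}_0$ be its full subcategory of $T_0$-spaces, and let $\mathsf{SobOpen}$ be its full subcategory of sober spaces, where a space is sober if each nonempty closed set that is not the union of two proper closed subsets is the closure of a unique point. Then none of the categories $\mathsf{TopOpen}$, $\mathsf{TopOpen}_0$, $\mathsf{SobOpen}$ has all binary products. Moreover, if $\mathbb S$ denotes the Sierpiński space, i.e. the two-point space $\{0,1\}$ with open sets $\emptyset$, $\{0\}$ and $\{0,1\}$, then the product of $\mathbb S$ with itself does not exist in $\mathsf{TopOpen}$, in $\mathsf{TopOpen}_0$, or in $\mathsf{SobOpen}$. -/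

import Mathlib

universe u
open CategoryTheory

/-- The property of a continuous map that the image of each open set is open. -/
def openMaps : MorphismProperty TopCat.{u} := fun _ _ f => IsOpenMap f

instance openMaps_isMultiplicative : openMaps.{u}.IsMultiplicative where
  id_mem _ := IsOpenMap.id
  comp_mem f g hf hg := IsOpenMap.comp (f := f) (g := g) hg hf

/-- The category of topological spaces and open maps, i.e. continuous maps that send open sets to
open sets. -/
abbrev TopOpen : Type (u + 1) := WideSubcategory openMaps.{u}

/-- The `T₀`-spaces among all topological spaces. -/
def isT0 : ObjectProperty TopOpen.{u} := fun X => T0Space X.obj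

/-- The sober spaces: every irreducible (in particular nonempty) closed subset is the closure of
a point, and this point is unique. Uniqueness of generic points amounts to the `T₀` axiom. -/
def isSober : ObjectProperty TopOpen.{u} := fun X => QuasiSober X.obj ∧ T0Space X.obj

/-- The full subcategory of `TopOpen` on the `T₀`-spaces. -/
abbrev TopOpenT0 : Type (u + 1) := isT0.{u}.FullSubcategory

/-- The full subcategory of `TopOpen` on the sober spaces. -/
abbrev SobOpen : Type (u + 1) := isSober.{u}.FullSubcategory

/-- The Sierpiński space: two points, exactly one of which is open. Its points are the two
propositions (moved to the universe `u`), and the open point is `True`. -/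
def sierpinski : TopOpen.{u} := ⟨TopCat.of (ULift.{u} Prop)⟩

theorem sierpinski_t0 : isT0 sierpinski.{u} :=
  (Homeomorph.ulift (X := Prop)).isEmbedding.t0Space

theorem quasiSober_prop : QuasiSober Prop := by
  refine ⟨fun {S} hS hc => ?_⟩
  by_cases h : True ∈ S
  · refine ⟨True, Set.Subset.antisymm (hc.closure_subset_iff.2 (by simpa using h)) fun x _ => ?_⟩
    rw [mem_closure_iff_nhds]
    intro U hU
    by_cases hx : x
    · have e : x = True := by simp [hx]
      exact ⟨True, e ▸ mem_of_mem_nhds hU, rfl⟩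
    · have e : x = False := by simp [hx]
      rw [e, nhds_false, Filter.mem_top] at hU
      exact ⟨True, hU ▸ Set.mem_univ _, rfl⟩
  · have e : ∀ z ∈ S, z = False := fun z hz => by
      by_contra hne
      have : z = True := by simpa using hne
      exact h (this ▸ hz)
    obtain ⟨x, hx⟩ := hS.nonempty
    refine ⟨x, Set.Subset.antisymm (hc.closure_subset_iff.2 (by simpa using hx)) fun y hy => ?_⟩
    rw [e y hy, ← e x hx]
    exact subset_closure rfl

theorem sierpinski_sober : isSober sierpinski.{u} :=
  have := quasiSober_prop
  ⟨(Homeomorph.ulift (X := Prop)).isOpenEmbedding.quasiSober, sierpinski_t0⟩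

/-- The Sierpiński space as a `T₀`-space. -/
def sierpinskiT0 : TopOpenT0.{u} := ⟨sierpinski, sierpinski_t0⟩

/-- The Sierpiński space as a sober space. -/
def sierpinskiSob : SobOpen.{u} := ⟨sierpinski, sierpinski_sober⟩

/-!
An open map from `X` to the Sierpiński space is the same as a dense open subset of `X`. Suppose
that `P`, with dense open subsets `U` and `V`, is a product of the Sierpiński space with itself.
Uniqueness of maps into `P` makes `P` a `T₀`-space, since interchanging two inseparable points is an
open automorphism of `(P, U, V)`. Given `T ⊆ P`, add one point to `P` whose neighbourhoods are
generated by the sets `{root} ∪ O` with `T ⊆ O` open in `P`. This extension is again `T₀`, and sober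
if `P` is. Whenever dense open sets of the extension restrict to `U` and `V`, the universal property
gives an open retraction of it onto `P`. The image `p` of the new point is a *root* of `T`: in the
specialization order, the points above `p` are `p` itself and the points above members of `T`. So
every `T` has a root in `P`, with prescribed membership in `U` and `V` wherever this is compatible
with `U` and `V` being open and dense (`TopOpen.not_isProduct_sierpinski`).

No partial order has this property (`not_forall_exists_isRoot`). Roots with suitable membership in
`U` and `V` provide four pairwise incomparable points, three of which generate an infinite
descending sequence of points incomparable to the fourth one, `r`. If `x` runs through points
incomparable to `r`, then the roots of `{x, r}` form an antichain; hence there is an infinite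
antichain `a`. Let `A n` be the set of points incomparable to `a i` for all `i < n`. The same
device turns `A (n + 3)` into an antichain in `A n`, and the roots of its subsets, with
`a (n + 1)` and `a (n + 2)` added, are distinct members of `A n`. By Cantor's theorem the cardinality
of `A (n + 3)` is less than that of `A n`, so the cardinals of `A (3 * k)` form an infinite strictly
descending sequence, which is absurd.
-/

/-! ### Partial orders with many roots -/

section Order

variable {P : Type*} [PartialOrder P]

/-- `p` is a root of `T` if the principal up-set of `p` consists of `p` and of the up-set
generated by `T`. Possibly `p ∈ T`, namely if `p` is the least element of `T`. -/
def IsRoot (p : P) (T : Set P) : Prop :=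
  ∀ y, p ≤ y ↔ y = p ∨ ∃ t ∈ T, t ≤ y

theorem IsRoot.le {p t : P} {T : Set P} (hp : IsRoot p T) (ht : t ∈ T) : p ≤ t :=
  (hp t).2 (.inr ⟨t, ht, le_rfl⟩)

theorem IsRoot.incompRel {p r : P} {T : Set P} (hp : IsRoot p T) (hT : T.Nonempty)
    (h : ∀ t ∈ T, IncompRel (· ≤ ·) t r) : IncompRel (· ≤ ·) p r := by
  obtain ⟨t, ht⟩ := hT
  have hr : ¬ r ≤ p := fun hrp => (h t ht).2 (hrp.trans (hp.le ht))
  refine ⟨fun hpr => ?_, hr⟩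
  rcases (hp r).1 hpr with rfl | ⟨s, hs, hsr⟩
  · exact hr le_rfl
  · exact (h s hs).1 hsr

/-- Adjoining the tag `r` turns every family of points incomparable to `r` into an antichain. -/
theorem IsRoot.eq_of_le {p q x y r : P} (hp : IsRoot p {x, r}) (hq : IsRoot q {y, r})
    (hx : IncompRel (· ≤ ·) x r) (hy : IncompRel (· ≤ ·) y r) (hpq : p ≤ q) : x = y := by
  have hqr : q ≤ r := hq.le (by simp)
  have hqy : q ≤ y := hq.le (by simp)
  have hxq : ¬ x ≤ q := fun h => hx.1 (h.trans hqr)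
  have hrq : ¬ r ≤ q := fun h => hy.2 (h.trans hqy)
  have hqp : q = p := by
    rcases (hp q).1 hpq with h | ⟨t, rfl | rfl, ht⟩
    · exact h
    · exact absurd ht hxq
    · exact absurd ht hrq
  subst hqp
  refine le_antisymm ?_ ?_
  · rcases (hp y).1 hqy with rfl | ⟨t, rfl | rfl, ht⟩
    · exact absurd hqr hy.1
    · exact ht
    · exact absurd ht hy.2
  · have hqx : q ≤ x := hp.le (by simp)
    rcases (hq x).1 hqx with rfl | ⟨t, rfl | rfl, ht⟩
    · exact absurd hqr hx.1
    · exact ht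
    · exact absurd ht hx.2

/-- Three pairwise incomparable points, all of them incomparable to `r`. -/
structure IsTriple (r x y z : P) : Prop where
  xy : IncompRel (· ≤ ·) x y
  yz : IncompRel (· ≤ ·) y z
  zx : IncompRel (· ≤ ·) z x
  xr : IncompRel (· ≤ ·) x r
  yr : IncompRel (· ≤ ·) y r
  zr : IncompRel (· ≤ ·) z r

theorem IsTriple.rotate {r x y z : P} (h : IsTriple r x y z) : IsTriple r y z x :=
  ⟨h.yz, h.zx, h.xy, h.yr, h.zr, h.xr⟩

theorem IsTriple.not_le_of_isRoot {r x y z p q : P} (h : IsTriple r x y z)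
    (hp : IsRoot p {y, z}) (hq : IsRoot q {z, x}) : ¬ p ≤ q := by
  intro hpq
  have hqz : q ≤ z := hq.le (by simp)
  have hqx : q ≤ x := hq.le (by simp)
  rcases (hp q).1 hpq with rfl | ⟨t, rfl | rfl, ht⟩
  · rcases (hp x).1 hqx with rfl | ⟨t, rfl | rfl, ht⟩
    · exact h.xy.1 (hp.le (by simp))
    · exact h.xy.2 ht
    · exact h.zx.1 ht
  · exact h.yz.1 (ht.trans hqz)
  · exact h.zx.1 (ht.trans hqx)

theorem IsTriple.not_le_of_isRoot' {r x y z p q : P} (h : IsTriple r x y z)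
    (hp : IsRoot p {y, z}) (hq : IsRoot q {z, x}) : ¬ q ≤ p := by
  intro hqp
  have hpz : p ≤ z := hp.le (by simp)
  have hpy : p ≤ y := hp.le (by simp)
  rcases (hq p).1 hqp with rfl | ⟨t, rfl | rfl, ht⟩
  · exact h.not_le_of_isRoot hp hq le_rfl
  · exact h.yz.2 (ht.trans hpy)
  · exact h.xy.1 (ht.trans hpy)

theorem IsTriple.next {r x y z p q s : P} (h : IsTriple r x y z)
    (hp : IsRoot p {y, z}) (hq : IsRoot q {z, x}) (hs : IsRoot s {x, y}) :
    IsTriple r p q s := by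
  refine ⟨⟨h.not_le_of_isRoot hp hq, h.not_le_of_isRoot' hp hq⟩,
    ⟨h.rotate.not_le_of_isRoot hq hs, h.rotate.not_le_of_isRoot' hq hs⟩,
    ⟨h.rotate.rotate.not_le_of_isRoot hs hp, h.rotate.rotate.not_le_of_isRoot' hs hp⟩,
    hp.incompRel ⟨y, by simp⟩ ?_, hq.incompRel ⟨z, by simp⟩ ?_, hs.incompRel ⟨x, by simp⟩ ?_⟩
  · rintro t (rfl | rfl)
    exacts [h.yr, h.zr]
  · rintro t (rfl | rfl)
    exacts [h.zr, h.xr]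
  · rintro t (rfl | rfl)
    exacts [h.xr, h.yr]

/-- Iterating the passage from a triple to the roots of its pairs gives an infinite descending
sequence, as two steps lead from a point to a strictly smaller one. -/
theorem IsTriple.exists_strictAnti (hroot : ∀ T : Set P, T.Nonempty → ∃ p, IsRoot p T)
    {r x y z : P} (h : IsTriple r x y z) :
    ∃ f : ℕ → P, StrictAnti f ∧ ∀ n, IncompRel (· ≤ ·) (f n) r := by
  let S := {x : P // ∃ y z, IsTriple r x y z}
  have : Nonempty S := ⟨⟨x, y, z, h⟩⟩
  have : NoMinOrder S := by
    refine ⟨?_⟩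
    rintro ⟨x, y, z, h⟩
    obtain ⟨p, hp⟩ := hroot {y, z} ⟨y, by simp⟩
    obtain ⟨q, hq⟩ := hroot {z, x} ⟨z, by simp⟩
    obtain ⟨s, hs⟩ := hroot {x, y} ⟨x, by simp⟩
    have h' := h.next hp hq hs
    obtain ⟨p', hp'⟩ := hroot {q, s} ⟨q, by simp⟩
    obtain ⟨q', hq'⟩ := hroot {s, p} ⟨s, by simp⟩
    obtain ⟨s', hs'⟩ := hroot {p, q} ⟨p, by simp⟩
    have hqx : q ≤ x := hq.le (by simp)
    have hsy : s ≤ y := hs.le (by simp)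
    have hpq : p' ≤ q := hp'.le (by simp)
    have hps : p' ≤ s := hp'.le (by simp)
    exact ⟨⟨p', q', s', h'.next hp' hq' hs'⟩,
      lt_of_le_not_ge (hpq.trans hqx) fun hx => h.xy.1 (le_trans hx (hps.trans hsy))⟩
  obtain ⟨f, hf⟩ := Nat.exists_strictAnti S
  refine ⟨fun n => (f n).1, fun m n hmn => hf hmn, fun n => ?_⟩
  obtain ⟨y, z, h⟩ := (f n).2
  exact h.xr

/-- Given three pairwise incomparable points `r`, `s`, `s'`, subsets of a set `H` of points
incomparable to them are encoded as points: `X ⊆ H` is sent to the root of the antichain that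
consists of `s`, `s'` and the roots of `{x, r}` for `x ∈ X`. -/
theorem exists_injective_set (hroot : ∀ T : Set P, T.Nonempty → ∃ p, IsRoot p T)
    {r s s' : P} (hrs : IncompRel (· ≤ ·) r s) (hrs' : IncompRel (· ≤ ·) r s')
    (hss' : IncompRel (· ≤ ·) s s') (H : Set P)
    (hr : ∀ x ∈ H, IncompRel (· ≤ ·) x r) (hs : ∀ x ∈ H, IncompRel (· ≤ ·) x s)
    (hs' : ∀ x ∈ H, IncompRel (· ≤ ·) x s') :
    ∃ q : Set H → P, Function.Injective q ∧ ∀ a, (∀ x ∈ H, IncompRel (· ≤ ·) x a) →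
      IncompRel (· ≤ ·) r a → IncompRel (· ≤ ·) s a → IncompRel (· ≤ ·) s' a →
      ∀ X, IncompRel (· ≤ ·) (q X) a := by
  choose c hc using fun x : H => hroot {x.1, r} ⟨r, by simp⟩
  have hca (a) (h : ∀ x ∈ H, IncompRel (· ≤ ·) x a) (hra : IncompRel (· ≤ ·) r a) (x) :
      IncompRel (· ≤ ·) (c x) a := by
    refine (hc x).incompRel ⟨r, by simp⟩ ?_
    rintro t (rfl | rfl)
    exacts [h _ x.2, hra]
  choose q hq using fun X : Set H => hroot (insert s (insert s' (c '' X))) ⟨s, by simp⟩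
  have key (X Y : Set H) (hXY : q X = q Y) : X ⊆ Y := by
    intro x hx
    have h1 : q Y ≤ c x := hXY ▸ (hq X).le (.inr (.inr ⟨x, hx, rfl⟩))
    have hqs : q Y ≤ s := (hq Y).le (by simp)
    rcases (hq Y _).1 h1 with h | ⟨t, rfl | rfl | ⟨y, hy, rfl⟩, ht⟩
    · exact absurd (h ▸ hqs) (hca s hs hrs x).1
    · exact absurd ht (hca _ hs hrs x).2
    · exact absurd ht (hca _ hs' hrs' x).2
    · have := (hc y).eq_of_le (hc x) (hr _ y.2) (hr _ x.2) ht
      rwa [← Subtype.ext this]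
  refine ⟨q, fun X Y h => (key X Y h).antisymm (key Y X h.symm), fun a h hra hsa hsa' X => ?_⟩
  refine (hq X).incompRel ⟨s, by simp⟩ ?_
  rintro t (rfl | rfl | ⟨y, -, rfl⟩)
  exacts [hsa, hsa', hca a h hra y]

/-- Cantor's theorem turns an infinite antichain into an infinite descending sequence of
cardinals: the points incomparable to the first `n` members of the antichain are at least as many
as the sets of points incomparable to the first `n + 3` members. -/
theorem not_exists_infinite_antichain (hroot : ∀ T : Set P, T.Nonempty → ∃ p, IsRoot p T)
    (a : ℕ → P) (ha : Pairwise fun i j => IncompRel (· ≤ ·) (a i) (a j)) : False := by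
  let A (n : ℕ) : Set P := {x | ∀ i < n, IncompRel (· ≤ ·) x (a i)}
  have key (n : ℕ) : Cardinal.mk (A (n + 3)) < Cardinal.mk (A n) := by
    obtain ⟨q, hq, hqa⟩ := exists_injective_set hroot (r := a n) (s := a (n + 1))
      (s' := a (n + 2)) (ha (by omega)) (ha (by omega)) (ha (by omega)) (A (n + 3))
      (fun x hx => hx _ (by omega)) (fun x hx => hx _ (by omega)) (fun x hx => hx _ (by omega))
    have hqA (X) : q X ∈ A n := fun i hi => hqa (a i) (fun x hx => hx _ (by omega))
      (ha (by omega)) (ha (by omega)) (ha (by omega)) X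
    calc Cardinal.mk (A (n + 3)) < Cardinal.mk (Set (A (n + 3))) := by
          rw [Cardinal.mk_set]; exact Cardinal.cantor _
      _ ≤ Cardinal.mk (A n) :=
          Cardinal.mk_le_of_injective (f := fun X => (⟨q X, hqA X⟩ : A n))
            fun X Y h => hq (congrArg Subtype.val h)
  exact not_strictAnti_of_wellFoundedLT (fun k => Cardinal.mk (A (3 * k)))
    (strictAnti_nat_of_succ_lt fun k => key (3 * k))

/-- A partial order with two distinguished up-sets `U` and `V` (two colours) cannot have roots of
all subsets in all colours that are compatible with `U` and `V` being up-sets that meet every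
principal up-set. -/
theorem not_forall_exists_isRoot {U V : Set P} (hU : IsUpperSet U) (hV : IsUpperSet V)
    (h : ∀ (T : Set P) (α β : Prop), (α → T ⊆ U) → (β → T ⊆ V) → (α ∨ T.Nonempty) →
      (β ∨ T.Nonempty) → ∃ p, (p ∈ U ↔ α) ∧ (p ∈ V ↔ β) ∧ IsRoot p T) : False := by
  have hroot' (T : Set P) (hT : T.Nonempty) : ∃ p, p ∉ U ∧ p ∉ V ∧ IsRoot p T := by
    simpa using h T False False (by simp) (by simp) (.inr hT) (.inr hT)
  have hroot (T : Set P) (hT : T.Nonempty) : ∃ p, IsRoot p T :=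
    (hroot' T hT).imp fun _ h => h.2.2
  -- The coloured points: a maximal one of both colours, and one of each single colour below it.
  obtain ⟨t, htU, htV, ht⟩ := h ∅ True True (by simp) (by simp) (by simp) (by simp)
  obtain ⟨a, haU, haV, ha⟩ := h {t} True False (by simpa using htU) (by simp) (by simp) (by simp)
  obtain ⟨b, hbU, hbV, hb⟩ := h {t} False True (by simp) (by simpa using htV) (by simp) (by simp)
  -- Four pairwise incomparable points without colour.
  obtain ⟨x, hxU, hxV, hx⟩ := hroot' {t} (by simp)
  obtain ⟨y, hyU, hyV, hy⟩ := hroot' {a} (by simp)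
  obtain ⟨z, hzU, hzV, hz⟩ := hroot' {b} (by simp)
  obtain ⟨r, hrU, hrV, hr⟩ := hroot' {a, b} (by simp)
  simp only [IsRoot, Set.mem_singleton_iff, Set.mem_insert_iff, exists_eq_left, exists_eq_or_imp,
    Set.mem_empty_iff_false, false_and, exists_false, or_false] at ht ha hb hx hy hz hr
  have htr : IsTriple r x y z := by
    have hU' := fun p q (hpq : p ≤ q) (hp : p ∈ U) => hU hpq hp
    have hV' := fun p q (hpq : p ≤ q) (hp : p ∈ V) => hV hpq hp
    constructor <;> constructor <;> grind
  obtain ⟨f, hf, hfr⟩ := htr.exists_strictAnti hroot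
  choose c hc using fun n => hroot {f n, r} (by simp)
  exact not_exists_infinite_antichain hroot c fun i j hij =>
    ⟨fun hle => hij (hf.injective ((hc i).eq_of_le (hc j) (hfr i) (hfr j) hle)),
      fun hle => hij (hf.injective ((hc j).eq_of_le (hc i) (hfr j) (hfr i) hle)).symm⟩

end Order

/-! ### Open one-point extensions -/

/-- The space `P` with one new point `root`, whose neighbourhoods are generated by the sets
`{root} ∪ O` for `O` open in `P` with `T ⊆ O`. Thus `P` is an open subspace, and the new point
is a root of `T` in the specialization order. -/
inductive RootExtension {P : Type*} (T : Set P)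
  | root : RootExtension T
  | incl (x : P) : RootExtension T

namespace RootExtension

open Topology

section Set

variable {P : Type*} {T : Set P}

theorem range_incl : Set.range (incl (T := T)) = {root}ᶜ := by
  ext (_ | x) <;> simp

variable (T) in
/-- The subset `A` of `P`, with the new point added if `α` holds. -/
def extend (A : Set P) (α : Prop) : Set (RootExtension T)
  | root => α
  | incl x => x ∈ A

theorem root_mem_extend {A : Set P} {α : Prop} : root ∈ extend T A α ↔ α := Iff.rfl

theorem incl_mem_extend {A : Set P} {α : Prop} {x : P} : incl x ∈ extend T A α ↔ x ∈ A := Iff.rfl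

end Set

variable {P : Type*} [TopologicalSpace P] {T : Set P}

instance : TopologicalSpace (RootExtension T) where
  IsOpen W := IsOpen (incl ⁻¹' W) ∧ (root ∈ W → T ⊆ incl ⁻¹' W)
  isOpen_univ := ⟨isOpen_univ, fun _ => Set.subset_univ _⟩
  isOpen_inter _ _ h h' :=
    ⟨h.1.inter h'.1, fun hn => Set.subset_inter (h.2 hn.1) (h'.2 hn.2)⟩
  isOpen_sUnion s hs := by
    refine ⟨?_, ?_⟩
    · rw [Set.preimage_sUnion]
      exact isOpen_biUnion fun W hW => (hs W hW).1
    · rintro ⟨W, hW, hn⟩ x hx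
      exact ⟨W, hW, (hs W hW).2 hn hx⟩

theorem isOpen_iff {W : Set (RootExtension T)} :
    IsOpen W ↔ IsOpen (incl ⁻¹' W) ∧ (root ∈ W → T ⊆ incl ⁻¹' W) :=
  Iff.rfl

theorem isOpenEmbedding_incl : IsOpenEmbedding (incl (T := T)) := by
  have hinj : Function.Injective (incl (T := T)) := fun _ _ h => by injection h
  refine .of_continuous_injective_isOpenMap ⟨fun W hW => hW.1⟩ hinj fun O hO => ?_
  rw [isOpen_iff, Set.preimage_image_eq _ hinj]
  exact ⟨hO, by simp⟩

theorem isClosed_root : IsClosed ({root} : Set (RootExtension T)) := by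
  rw [← isOpen_compl_iff, ← range_incl]
  exact isOpenEmbedding_incl.isOpen_range

instance [T0Space P] : T0Space (RootExtension T) := by
  refine (t0Space_iff_inseparable _).2 fun x y h => ?_
  have hn (z) (hz : Inseparable (incl z) (root : RootExtension T)) : False := by
    simpa using hz.mem_closed_iff isClosed_root
  rcases x with _ | x <;> rcases y with _ | y
  · rfl
  · exact (hn y h.symm).elim
  · exact (hn x h).elim
  · exact congrArg _ (isOpenEmbedding_incl.isInducing.inseparable_iff.1 h).eq

/-- A closed irreducible set is either `{root}` or the closure of its nonempty trace on `P`. -/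
instance [QuasiSober P] : QuasiSober (RootExtension T) := by
  refine ⟨fun {F} hF hc => ?_⟩
  by_cases hne : (F ∩ Set.range (incl (T := T))).Nonempty
  · obtain ⟨x, hx⟩ := QuasiSober.sober (hF.preimage isOpenEmbedding_incl hne)
      (hc.preimage isOpenEmbedding_incl.continuous)
    refine ⟨incl x, Set.Subset.antisymm
      (hc.closure_subset_iff.2 (Set.singleton_subset_iff.2 hx.mem)) ?_⟩
    calc F ⊆ closure (F ∩ Set.range (incl (T := T))) :=
          subset_closure_inter_of_isPreirreducible_of_isOpen hF.2
            isOpenEmbedding_incl.isOpen_range hne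
      _ ⊆ closure {incl x} := by
        refine closure_minimal ?_ isClosed_closure
        rintro _ ⟨hy, y, rfl⟩
        rw [← specializes_iff_mem_closure]
        exact (specializes_iff_mem_closure.2 (hx.symm ▸ hy)).map isOpenEmbedding_incl.continuous
  · refine ⟨root, ?_⟩
    have : F = {root} := by
      refine hF.1.subset_singleton_iff.1 fun x hx => ?_
      by_contra h
      exact hne ⟨x, hx, by rw [range_incl]; exact h⟩
    exact this ▸ isClosed_root.closure_eq

theorem isOpen_extend {A : Set P} (hA : IsOpen A) {α : Prop} (h : α → T ⊆ A) :
    IsOpen (extend T A α) :=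
  isOpen_iff.2 ⟨hA, h⟩

theorem dense_extend {A : Set P} (hA : Dense A) {α : Prop} (h : α ∨ T.Nonempty) :
    Dense (extend T A α) := by
  have key (O : Set (RootExtension T)) (hO : IsOpen O) (x : P) (hx : incl x ∈ O) :
      (O ∩ extend T A α).Nonempty := by
    obtain ⟨y, hy, hyA⟩ := hA.inter_open_nonempty _ (isOpen_iff.1 hO).1 ⟨x, hx⟩
    exact ⟨incl y, hy, incl_mem_extend.2 hyA⟩
  refine dense_iff_inter_open.2 fun O hO ⟨x, hx⟩ => ?_
  rcases x with _ | x
  · rcases h with h | ⟨t, ht⟩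
    · exact ⟨root, hx, root_mem_extend.2 h⟩
    · exact key O hO t ((isOpen_iff.1 hO).2 hx ht)
  · exact key O hO x hx

attribute [local instance] specializationOrder in
/-- An open retraction of the one-point extension onto `P` sends the new point to a root of `T`:
it preserves principal up-sets, which are intersections of open sets. -/
theorem isRoot_of_retraction [T0Space P] {r : RootExtension T → P} (hc : Continuous r)
    (ho : IsOpenMap r) (hr : ∀ x, r (incl x) = x) : IsRoot (r root) T := by
  intro y
  constructor
  · intro (hy : y ⤳ r root)
    by_contra! hne
    -- Otherwise `(closure {y})ᶜ` is an open set that contains `T` but not `y`. Adding the new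
    -- point gives an open set whose image is a neighbourhood of `r root` without `y`.
    have hcl (t) (ht : t ∈ T) : y ∉ (closure {y})ᶜ ∧ t ∈ (closure {y})ᶜ :=
      ⟨fun h => h (subset_closure rfl), fun h => hne.2 t ht (specializes_iff_mem_closure.2 h)⟩
    have hO := ho _ (isOpen_extend (T := T) (α := True) isClosed_closure.isOpen_compl
      fun _ t ht => (hcl t ht).2)
    obtain ⟨z, hz, hzy⟩ := hy.mem_open hO ⟨root, root_mem_extend.2 trivial, rfl⟩
    rcases z with _ | z
    · exact hne.1 hzy.symm
    · rw [hr] at hzy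
      subst hzy
      exact incl_mem_extend.1 hz (subset_closure rfl)
  · rintro (rfl | ⟨t, ht, hty⟩)
    · exact le_rfl
    · refine le_trans (b := t) ?_ hty
      change t ⤳ r root
      refine specializes_iff_forall_open.2 fun W hW hn => ?_
      have := (isOpen_iff.1 (hW.preimage hc)).2 hn ht
      have h : r (incl t) ∈ W := this
      rwa [hr] at h

end RootExtension

/-! ### Open maps to the Sierpiński space -/

namespace TopOpen

open RootExtension

theorem isOpen_of_true_mem {s : Set Prop} (h : True ∈ s) : IsOpen s := by
  by_cases hF : False ∈ s
  · convert isOpen_univ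
    ext p
    by_cases hp : p <;> simp [hp, h, hF]
  · convert isOpen_singleton_true
    ext p
    by_cases hp : p <;> simp [hp, h, hF]

/-- The open map to the Sierpiński space that a dense open set `A` defines: it sends the points
of `A` to the open point. -/
def toSierpinski {X : TopOpen.{u}} (A : Set X.obj) (hA : IsOpen A) (hd : Dense A) :
    X ⟶ sierpinski.{u} where
  hom := TopCat.ofHom ⟨fun x => ULift.up (x ∈ A), continuous_uliftUp.comp (continuous_Prop.2 hA)⟩
  property := by
    intro O hO
    rcases O.eq_empty_or_nonempty with rfl | hne
    · rw [Set.image_empty]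
      exact isOpen_empty
    · obtain ⟨x, hx, hxA⟩ := hd.inter_open_nonempty O hO hne
      have : IsOpen ((fun x => x ∈ A) '' O) := isOpen_of_true_mem ⟨x, hx, by simpa using hxA⟩
      convert Homeomorph.ulift.symm.isOpenMap _ this using 1
      rw [Set.image_image]
      rfl

/-- The set of points that a map to the Sierpiński space sends to the open point. -/
def support {X : TopOpen.{u}} (f : X ⟶ sierpinski.{u}) : Set X.obj := {x | (f.hom x).down}

theorem isOpen_support {X : TopOpen.{u}} (f : X ⟶ sierpinski.{u}) : IsOpen (support f) :=
  continuous_Prop.1 (continuous_uliftDown.comp f.hom.hom.continuous)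

theorem dense_support {X : TopOpen.{u}} (f : X ⟶ sierpinski.{u}) : Dense (support f) := by
  refine dense_iff_inter_open.2 fun O hO ⟨x, hx⟩ => ?_
  have h1 : IsOpen (ULift.down '' (f.hom '' O)) :=
    Homeomorph.ulift.isOpenMap _ (f.property O hO)
  -- A nonempty open set of propositions contains `True`.
  have h2 : True ∈ ULift.down '' (f.hom '' O) := by
    have hmem : (f.hom x).down ∈ ULift.down '' (f.hom '' O) := ⟨_, ⟨x, hx, rfl⟩, rfl⟩
    by_cases h : (f.hom x).down
    · simpa only [h] using hmem
    · have e : (f.hom x).down = False := by simpa using h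
      rw [e] at hmem
      have := h1.mem_nhds hmem
      rw [nhds_false, Filter.mem_top] at this
      exact this ▸ Set.mem_univ _
  obtain ⟨_, ⟨y, hy, rfl⟩, hy'⟩ := h2
  exact ⟨y, hy, of_eq_true hy'⟩

theorem hom_ext_support {X : TopOpen.{u}} {f g : X ⟶ sierpinski.{u}}
    (h : support f = support g) : f = g := by
  refine WideSubcategory.hom_ext _ (TopCat.hom_ext (ContinuousMap.ext fun x => ULift.ext _ _ ?_))
  exact propext (Set.ext_iff.1 h x)

/-! ### Products of the Sierpiński space with itself -/

/-- The one-point extension as an object of the category of open maps. -/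
def rootExtension (P : TopOpen.{u}) (T : Set P.obj) : TopOpen.{u} :=
  ⟨TopCat.of (RootExtension T)⟩

/-- The inclusion into the one-point extension as an open map. -/
def inclHom (P : TopOpen.{u}) (T : Set P.obj) : P ⟶ rootExtension P T where
  hom := TopCat.ofHom ⟨incl, isOpenEmbedding_incl.continuous⟩
  property := isOpenEmbedding_incl.isOpenMap

/-- If only the identity of `P` is compatible with `p₁` and `p₂`, then `P` is a `T₀`-space:
otherwise two inseparable points can be interchanged. -/
theorem t0Space_of_forall_eq_id {P : TopOpen.{u}} {p₁ p₂ : P ⟶ sierpinski.{u}}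
    (huniq : ∀ h : P ⟶ P, h ≫ p₁ = p₁ → h ≫ p₂ = p₂ → h = 𝟙 P) : T0Space P.obj := by
  classical
  refine (t0Space_iff_inseparable _).2 fun x y hxy => ?_
  have hpre (O : Set P.obj) (hO : IsOpen O) : Equiv.swap x y ⁻¹' O = O := by
    ext z
    have := hxy.mem_open_iff hO
    rw [Set.mem_preimage, Equiv.swap_apply_def]
    split_ifs with h1 h2
    · subst h1; exact this.symm
    · subst h2; exact this
    · rfl
  let s : P ⟶ P :=
    { hom := TopCat.ofHom ⟨Equiv.swap x y, ⟨fun O hO => (hpre O hO).symm ▸ hO⟩⟩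
      property := fun O hO => by
        change IsOpen (Equiv.swap x y '' O)
        rw [Equiv.image_eq_preimage_symm, Equiv.symm_swap, hpre O hO]
        exact hO }
  have hs : s = 𝟙 P := huniq s
    (hom_ext_support (hpre _ (isOpen_support p₁))) (hom_ext_support (hpre _ (isOpen_support p₂)))
  have h : s.hom x = x := by rw [hs]; rfl
  exact h.symm.trans (Equiv.swap_apply_left x y)

/-- No pair of open maps to the Sierpiński space has the universal property of a product with
respect to the space itself and its one-point extensions. -/
theorem not_isProduct_sierpinski {P : TopOpen.{u}} {p₁ p₂ : P ⟶ sierpinski.{u}}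
    (huniq : ∀ h : P ⟶ P, h ≫ p₁ = p₁ → h ≫ p₂ = p₂ → h = 𝟙 P)
    (hlift : ∀ (T : Set P.obj) (f g : rootExtension P T ⟶ sierpinski.{u}),
      ∃ h : rootExtension P T ⟶ P, h ≫ p₁ = f ∧ h ≫ p₂ = g) : False := by
  have := t0Space_of_forall_eq_id huniq
  let := specializationOrder P.obj
  have hup (f : P ⟶ sierpinski.{u}) : IsUpperSet (support f) :=
    fun x y (hxy : y ⤳ x) hx => hxy.mem_open (isOpen_support f) hx
  refine not_forall_exists_isRoot (hup p₁) (hup p₂) fun T α β hα hβ hα' hβ' => ?_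
  obtain ⟨r, h₁, h₂⟩ := hlift T
    (toSierpinski (extend T (support p₁) α) (isOpen_extend (isOpen_support p₁) hα)
      (dense_extend (dense_support p₁) hα'))
    (toSierpinski (extend T (support p₂) β) (isOpen_extend (isOpen_support p₂) hβ)
      (dense_extend (dense_support p₂) hβ'))
  have e₁ : r.hom ⁻¹' support p₁ = extend T (support p₁) α := congrArg support h₁
  have e₂ : r.hom ⁻¹' support p₂ = extend T (support p₂) β := congrArg support h₂
  have hid : inclHom P T ≫ r = 𝟙 P := by
    refine huniq _ ?_ ?_
    · rw [Category.assoc, h₁]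
      exact hom_ext_support rfl
    · rw [Category.assoc, h₂]
      exact hom_ext_support rfl
  refine ⟨r.hom (root : RootExtension T), ?_, ?_, isRoot_of_retraction r.hom.hom.continuous
    r.property fun x => congrArg (fun k : P ⟶ P => k.hom x) hid⟩
  · exact (Set.ext_iff.1 e₁ root).trans root_mem_extend
  · exact (Set.ext_iff.1 e₂ root).trans root_mem_extend

theorem isT0_rootExtension {P : TopOpen.{u}} (hP : isT0 P) (T : Set P.obj) :
    isT0 (rootExtension P T) :=
  have : T0Space P.obj := hP
  inferInstanceAs (T0Space (RootExtension T))

theorem isSober_rootExtension {P : TopOpen.{u}} (hP : isSober P) (T : Set P.obj) :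
    isSober (rootExtension P T) :=
  have : QuasiSober P.obj := hP.1
  ⟨inferInstanceAs (QuasiSober (RootExtension T)), isT0_rootExtension hP.2 T⟩

/-- In a full subcategory of the category of open maps that contains the Sierpiński space and is
closed under one-point extensions, the Sierpiński space has no product with itself. -/
theorem not_hasBinaryProduct_sierpinski {C : Type*} [Category C] (F : C ⥤ TopOpen.{u}) [F.Full]
    [F.Faithful] {s : C} (e : F.obj s ≅ sierpinski.{u})
    (hF : ∀ (P : C) (T : Set (F.obj P).obj),
      ∃ Y : C, Nonempty (F.obj Y ≅ rootExtension (F.obj P) T)) :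
    ¬ Limits.HasBinaryProduct s s := by
  intro _
  refine not_isProduct_sierpinski (P := F.obj (s ⨯ s)) (p₁ := F.map Limits.prod.fst ≫ e.hom)
    (p₂ := F.map Limits.prod.snd ≫ e.hom) (fun h h₁ h₂ => ?_) fun T f g => ?_
  · obtain ⟨h, rfl⟩ := F.map_surjective h
    rw [← Category.assoc, cancel_mono, ← F.map_comp] at h₁ h₂
    rw [Limits.prod.hom_ext (f := h) (g := 𝟙 _) (by simpa using F.map_injective h₁)
      (by simpa using F.map_injective h₂), F.map_id]
  · obtain ⟨Y, ⟨i⟩⟩ := hF _ T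
    refine ⟨i.inv ≫ F.map (Limits.prod.lift (F.preimage (i.hom ≫ f ≫ e.inv))
      (F.preimage (i.hom ≫ g ≫ e.inv))), ?_, ?_⟩
    · simp only [Category.assoc, ← F.map_comp_assoc, Limits.prod.lift_fst, F.map_preimage,
        Iso.inv_hom_id, Iso.inv_hom_id_assoc, Category.comp_id]
    · simp only [Category.assoc, ← F.map_comp_assoc, Limits.prod.lift_snd, F.map_preimage,
        Iso.inv_hom_id, Iso.inv_hom_id_assoc, Category.comp_id]

end TopOpen

theorem theorem3p7 :
    (¬ Limits.HasBinaryProducts TopOpen.{u} ∧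
      ¬ Limits.HasBinaryProducts TopOpenT0.{u} ∧
      ¬ Limits.HasBinaryProducts SobOpen.{u}) ∧
    (¬ Limits.HasBinaryProduct sierpinski.{u} sierpinski.{u} ∧
      ¬ Limits.HasBinaryProduct sierpinskiT0.{u} sierpinskiT0.{u} ∧
      ¬ Limits.HasBinaryProduct sierpinskiSob.{u} sierpinskiSob.{u}) := by
  have h : ¬ Limits.HasBinaryProduct sierpinski.{u} sierpinski.{u} :=
    TopOpen.not_hasBinaryProduct_sierpinski (𝟭 _) (Iso.refl _) fun P T => ⟨_, ⟨Iso.refl _⟩⟩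
  have h₀ : ¬ Limits.HasBinaryProduct sierpinskiT0.{u} sierpinskiT0.{u} :=
    TopOpen.not_hasBinaryProduct_sierpinski isT0.ι (Iso.refl _) fun P T =>
      ⟨⟨_, TopOpen.isT0_rootExtension P.property T⟩, ⟨Iso.refl _⟩⟩
  have hs : ¬ Limits.HasBinaryProduct sierpinskiSob.{u} sierpinskiSob.{u} :=
    TopOpen.not_hasBinaryProduct_sierpinski isSober.ι (Iso.refl _) fun P T =>
      ⟨⟨_, TopOpen.isSober_rootExtension P.property T⟩, ⟨Iso.refl _⟩⟩
  exact ⟨⟨fun _ => h inferInstance, fun _ => h₀ inferInstance, fun _ => hs inferInstance⟩,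
    h, h₀, hs⟩
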